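/- All spaces are completely regular. A space $X$ is *Menger* if for every sequence $(\mathcal U_n)_{n\in\omega}$ of open covers of $X$ there are finite $\mathcal V_n\subseteq\mathcal U_n$ such that $\bigcup_n\mathcal V_n$ covers $X$; it is *Hurewicz* if for every such sequence there are finite $\mathcal V_n\subseteq\mathcal U_n$ such that every $x\in X$ belongs to $\bigcup\mathcal V_n$ for all but finitely many $n$. For a topological property $P$, a space $X$ is *projectively $P$* if for every separable metrizable space $Y$ and every continuous $f:X\to Y$, the subspace $f(X)$ of $Y$ has property $P$. A separable metrizable space is *analytic* if it is empty or a continuous image of $\omega^\omega$. The *$\sigma$-projective* subsets of Polish spaces form the smallest family of subsets of Polish spaces that contains the open sets and is closed under complements, countable unions and images under continuous maps between Polish spaces; a separable metrizable space is *$\sigma$-projective* if it is homeomorphic to a $\sigma$-projective subset of a Polish space. *$\sigma$-projective determinacy* is the statement that for every $\sigma$-projective $A\subseteq\omega^\omega$, the two-player perfect-information game of length $\omega$ with natural-number moves and payoff set $A$ has a winning strategy for one of the players. **Theorem.** (1) (In ZFC) Every Menger projectively analytic space is Hurewicz. (2) Assuming $\sigma$-projective determinacy, every Menger projectively $\sigma$-projective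 space is Hurewicz. -/

import Mathlib

open Set Filter Topology MeasureTheory

universe u

namespace DefinableMenger

/-- `X` is Menger: for every sequence of open covers one can choose finite subfamilies, one from
each cover, that together cover `X`. -/
def IsMenger (X : Type u) [TopologicalSpace X] : Prop :=
  ∀ U : ℕ → Set (Set X), (∀ n, (∀ s ∈ U n, IsOpen s) ∧ ⋃₀ U n = univ) →
    ∃ V : ℕ → Set (Set X), (∀ n, V n ⊆ U n ∧ (V n).Finite) ∧ ∀ x : X, ∃ n, x ∈ ⋃₀ V n

/-- `X` is Hurewicz: for every sequence of open covers one can choose finite subfamilies, one from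
each cover, so that every point lies in the union of all but finitely many of them. -/
def IsHurewicz (X : Type u) [TopologicalSpace X] : Prop :=
  ∀ U : ℕ → Set (Set X), (∀ n, (∀ s ∈ U n, IsOpen s) ∧ ⋃₀ U n = univ) →
    ∃ V : ℕ → Set (Set X), (∀ n, V n ⊆ U n ∧ (V n).Finite) ∧
      ∀ x : X, ∀ᶠ n in atTop, x ∈ ⋃₀ V n

/-- The σ-projective subsets of Polish spaces: the smallest family of subsets of Polish spaces
that contains the open sets and is closed under complements, countable unions and images under
continuous maps between Polish spaces. -/
inductive SigmaProjectiveSet : ∀ (P : Type) [TopologicalSpace P], Set P → Prop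
  | isOpen (P : Type) [TopologicalSpace P] [PolishSpace P] (A : Set P) :
      IsOpen A → SigmaProjectiveSet P A
  | compl (P : Type) [TopologicalSpace P] [PolishSpace P] (A : Set P) :
      SigmaProjectiveSet P A → SigmaProjectiveSet P Aᶜ
  | iUnion (P : Type) [TopologicalSpace P] [PolishSpace P] (A : ℕ → Set P) :
      (∀ n, SigmaProjectiveSet P (A n)) → SigmaProjectiveSet P (⋃ n, A n)
  | image (P Q : Type) [TopologicalSpace P] [PolishSpace P] [TopologicalSpace Q] [PolishSpace Q]
      (f : P → Q) (A : Set P) :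
      Continuous f → SigmaProjectiveSet P A → SigmaProjectiveSet Q (f '' A)

/-- A (separable metrizable) space is analytic if it is empty or a continuous image of the Baire
space `ℕ → ℕ`. -/
def IsAnalyticSpace (Y : Type) [TopologicalSpace Y] : Prop :=
  AnalyticSet (univ : Set Y)

/-- A space is σ-projective if it is homeomorphic to a σ-projective subset of a Polish space. -/
def IsSigmaProjectiveSpace (Y : Type) [TopologicalSpace Y] : Prop :=
  ∃ (P : Type) (_ : TopologicalSpace P) (_ : PolishSpace P) (e : Y → P),
    IsEmbedding e ∧ SigmaProjectiveSet P (range e)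

/-- `X` is projectively `Prp`: whenever `f` is a continuous map from `X` to a separable metrizable
space, the space `f(X)` has property `Prp`.
Separable metrizable spaces have at most continuum many points, so those in `Type` represent them
all up to homeomorphism. -/
def Projectively (Prp : ∀ (Y : Type) [TopologicalSpace Y], Prop)
    (X : Type u) [TopologicalSpace X] : Prop :=
  ∀ (Y : Type) [TopologicalSpace Y] [TopologicalSpace.SeparableSpace Y]
    [TopologicalSpace.MetrizableSpace Y] (f : X → Y), Continuous f → Prp (range f)

/-- The first `n` moves of the play `x`. -/
def position (x : ℕ → ℕ) (n : ℕ) : List ℕ := (List.range n).map x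

/-- The play `x` (player I makes the moves `x 0, x 2, …`) is consistent with the strategy `σ` of
player I. -/
def FollowsI (σ : List ℕ → ℕ) (x : ℕ → ℕ) : Prop :=
  ∀ n, x (2 * n) = σ (position x (2 * n))

/-- The play `x` (player II makes the moves `x 1, x 3, …`) is consistent with the strategy `τ` of
player II. -/
def FollowsII (τ : List ℕ → ℕ) (x : ℕ → ℕ) : Prop :=
  ∀ n, x (2 * n + 1) = τ (position x (2 * n + 1))

/-- The perfect information game of length ω on `ℕ` with payoff set `A` for player I is
determined: one of the players has a winning strategy. -/
def Determined (A : Set (ℕ → ℕ)) : Prop :=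
  (∃ σ : List ℕ → ℕ, ∀ x, FollowsI σ x → x ∈ A) ∨
    (∃ τ : List ℕ → ℕ, ∀ x, FollowsII τ x → x ∉ A)

/-- σ-projective determinacy. -/
def SigmaPD : Prop :=
  ∀ A : Set (ℕ → ℕ), SigmaProjectiveSet (ℕ → ℕ) A → Determined A

end DefinableMenger

/-! Completely regular Menger spaces are Lindelöf, so each given cover has a countable cozero
refinement. All the functions defining these refinements form one map `F` from `X` to the Hilbert
cube. Pull `F(X)` back along a continuous surjection from the Cantor space: compactness keeps the
preimage Menger, and the cozero sets become open sets that split into clopen ones. Sending a point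
to the first clopen set containing it, cover by cover, gives a Menger set `C ⊆ ω^ω` of the same
definability class as `F(X)`; an eventual bound for `C` yields the Hurewicz selection
(`IsMenger.isHurewicz`).

It remains to bound `C`. If `f : ω^ω → C` is continuous with undominated range, a tree of splitting
coordinates gives a continuous `d`, defined on all of `ω^ω`, with `d ∘ f` onto
(`exists_continuous_surjective_comp`). Then `d` maps `C` onto `ω^ω`, which is not Menger. For
analytic nonempty `C`, take `f` with range `C`. For σ-projective `C`, play the domination game: a
win for I produces such an `f`, a win for II bounds `C`. -/

namespace DefinableMenger

/-! ### Eventual domination -/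

/-- `S ⊆ ω^ω` is bounded with respect to eventual domination. -/
def EventuallyDominated (S : Set (ℕ → ℕ)) : Prop :=
  ∃ g : ℕ → ℕ, ∀ y ∈ S, ∀ᶠ n in atTop, y n ≤ g n

lemma EventuallyDominated.mono {S T : Set (ℕ → ℕ)} (hT : EventuallyDominated T) (h : S ⊆ T) :
    EventuallyDominated S := by
  obtain ⟨g, hg⟩ := hT
  exact ⟨g, fun y hy => hg y (h hy)⟩

lemma EventuallyDominated.iUnion {ι : Type*} [Countable ι] {S : ι → Set (ℕ → ℕ)}
    (hS : ∀ i, EventuallyDominated (S i)) : EventuallyDominated (⋃ i, S i) := by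
  choose g hg using hS
  obtain ⟨e, he⟩ := exists_injective_nat ι
  have hfin : ∀ n, {i | e i ≤ n}.Finite := fun n =>
    (Set.finite_Iic n).preimage he.injOn
  -- Diagonal bound: at `n` only the finitely many sets with code at most `n` count.
  refine ⟨fun n => (hfin n).toFinset.sup fun i => g i n, fun y hy => ?_⟩
  obtain ⟨i, hi⟩ := mem_iUnion.1 hy
  filter_upwards [hg i y hi, eventually_ge_atTop (e i)] with n hn hin
  exact hn.trans (Finset.le_sup (f := fun i => g i n) ((hfin n).mem_toFinset.2 hin))

lemma EventuallyDominated.biUnion {α : Type*} {t : Set α} (ht : t.Countable)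
    {S : α → Set (ℕ → ℕ)} (hS : ∀ i ∈ t, EventuallyDominated (S i)) :
    EventuallyDominated (⋃ i ∈ t, S i) := by
  have := ht.to_subtype
  rw [biUnion_eq_iUnion]
  exact EventuallyDominated.iUnion fun i => hS i i.2

lemma EventuallyDominated.union {S T : Set (ℕ → ℕ)} (hS : EventuallyDominated S)
    (hT : EventuallyDominated T) : EventuallyDominated (S ∪ T) := by
  rw [union_eq_iUnion]
  exact EventuallyDominated.iUnion fun b => by cases b <;> assumption

lemma EventuallyDominated.of_finite_image {S : Set (ℕ → ℕ)}
    (h : ∀ᶠ n in atTop, ((fun y : ℕ → ℕ => y n) '' S).Finite) : EventuallyDominated S := by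
  have : ∀ n, ∃ b, ((fun y : ℕ → ℕ => y n) '' S).Finite → ∀ y ∈ S, y n ≤ b := fun n => by
    by_cases hn : ((fun y : ℕ → ℕ => y n) '' S).Finite
    · obtain ⟨b, hb⟩ := hn.bddAbove
      exact ⟨b, fun _ y hy => hb (mem_image_of_mem _ hy)⟩
    · exact ⟨0, fun h => absurd h hn⟩
  choose g hg using this
  exact ⟨g, fun y hy => h.mono fun n hn => hg n hn y hy⟩

/-! ### Menger subsets -/

/-- The Menger property of a subset `A` of a space, in terms of countable covers of `A` by open
sets of the ambient space. -/
def MengerSubset {Z : Type*} [TopologicalSpace Z] (A : Set Z) : Prop :=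
  ∀ W : ℕ → ℕ → Set Z, (∀ n k, IsOpen (W n k)) → (∀ n, A ⊆ ⋃ k, W n k) →
    ∃ g : ℕ → ℕ, ∀ a ∈ A, ∃ n, ∃ k ≤ g n, a ∈ W n k

lemma MengerSubset.image_of_continuousOn {Y Z : Type*} [TopologicalSpace Y] [TopologicalSpace Z]
    {A : Set Y} (hA : MengerSubset A) {f : Y → Z} (hf : ContinuousOn f A) :
    MengerSubset (f '' A) := by
  intro W hW hcov
  have : ∀ n k, ∃ U, IsOpen U ∧ f ⁻¹' W n k ∩ A = U ∩ A := fun n k =>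
    continuousOn_iff'.1 hf _ (hW n k)
  choose U hUo hU using this
  have hmem : ∀ n k, ∀ a ∈ A, (f a ∈ W n k ↔ a ∈ U n k) := fun n k a ha => by
    simpa [ha] using Set.ext_iff.1 (hU n k) a
  obtain ⟨g, hg⟩ := hA U hUo fun n a ha => by
    obtain ⟨k, hk⟩ := mem_iUnion.1 (hcov n (mem_image_of_mem f ha))
    exact mem_iUnion.2 ⟨k, (hmem n k a ha).1 hk⟩
  refine ⟨g, ?_⟩
  rintro _ ⟨a, ha, rfl⟩
  obtain ⟨n, k, hk, h⟩ := hg a ha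
  exact ⟨n, k, hk, (hmem n k a ha).2 h⟩

/-- Tube argument: fibres are compact and `φ` is closed, so a finite stage of a cover that contains
a fibre contains all nearby fibres. -/
lemma MengerSubset.preimage_of_compactSpace {Y Z : Type*} [TopologicalSpace Y] [CompactSpace Y]
    [TopologicalSpace Z] [T2Space Z] {A : Set Z} (hA : MengerSubset A) {φ : Y → Z}
    (hφ : Continuous φ) : MengerSubset (φ ⁻¹' A) := by
  intro W hW hcov
  have hWo : ∀ n k, IsOpen (accumulate (W n) k) := fun n k =>
    isOpen_biUnion fun j _ => hW n j
  obtain ⟨g, hg⟩ := hA (fun n k => (φ '' (accumulate (W n) k)ᶜ)ᶜ)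
    (fun n k => (hφ.isClosedMap _ (hWo n k).isClosed_compl).isOpen_compl) fun n a ha => by
      obtain ⟨k, hk⟩ := (isClosed_singleton.preimage hφ).isCompact.elim_directed_cover
        (accumulate (W n)) (hWo n) (s := φ ⁻¹' {a}) (by
          rw [iUnion_accumulate]
          exact (preimage_mono (singleton_subset_iff.2 ha)).trans (hcov n))
        monotone_accumulate.directed_le
      refine mem_iUnion.2 ⟨k, ?_⟩
      rintro ⟨x, hx, hxa⟩
      exact hx (hk hxa)
  refine ⟨g, fun x hx => ?_⟩
  obtain ⟨n, k, hk, h⟩ := hg _ hx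
  by_contra! hcon
  refine h ⟨x, fun hx' => ?_, rfl⟩
  obtain ⟨j, hj, hxj⟩ := mem_accumulate.1 hx'
  exact hcon n j (hj.trans hk) hxj

lemma MengerSubset.image_ne_univ {Z : Type*} [TopologicalSpace Z] {C : Set Z}
    (hC : MengerSubset C) {d : Z → ℕ → ℕ} (hd : Continuous d) : d '' C ≠ univ := by
  intro h
  obtain ⟨g, hg⟩ := hC (fun n k => {y | d y n = k})
    (fun n k => (isOpen_discrete {k}).preimage ((continuous_apply n).comp hd))
    (fun n y _ => by simp)
  -- The sequence `g + 1` exceeds `g` everywhere, so no selection bounded by `g` catches it.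
  obtain ⟨y, hy, hyd⟩ := (h ▸ mem_univ (fun n => g n + 1) : (fun n => g n + 1) ∈ d '' C)
  obtain ⟨n, k, hk, hnk⟩ := hg y hy
  have := congrFun hyd n
  simp only [mem_ofPred_eq] at hnk this
  omega

/-! ### Mapping an undominated range onto Baire space -/

section Scheme

variable {f : (ℕ → ℕ) → ℕ → ℕ}

/-- The points all of whose neighbourhoods have a non-dominated image under `f`. -/
def undominatedPoints (f : (ℕ → ℕ) → ℕ → ℕ) : Set (ℕ → ℕ) :=
  {x | ∀ U ∈ 𝓝 x, ¬ EventuallyDominated (f '' U)}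

/-- By the Lindelöf property, points with a dominated neighbourhood contribute only a dominated set.
The remaining image is undominated, so some coordinate takes infinitely many values on it; `ψ`
decodes these as all of `ω`. -/
lemma exists_splitting_coordinate {U : Set (ℕ → ℕ)}
    (hU : ¬ EventuallyDominated (f '' U)) :
    ∃ (N : ℕ) (ψ : ℕ → ℕ), ∀ i, ∃ x ∈ U ∩ undominatedPoints f, ψ (f x N) = i := by
  have h1 : EventuallyDominated (f '' (U \ undominatedPoints f)) := by
    have : ∀ x, ∃ V, V ∈ 𝓝 x ∧ (x ∈ U \ undominatedPoints f → EventuallyDominated (f '' V)) := by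
      intro x
      by_cases hx : x ∈ undominatedPoints f
      · exact ⟨univ, univ_mem, fun h => absurd hx h.2⟩
      · simp only [undominatedPoints, mem_ofPred_eq, not_forall, not_not] at hx
        obtain ⟨V, hV, hV'⟩ := hx
        exact ⟨V, hV, fun _ => hV'⟩
    choose V hV hVd using this
    obtain ⟨t, htU, htc, hcov⟩ := TopologicalSpace.countable_cover_nhdsWithin
      (s := U \ undominatedPoints f) (f := V) fun x _ => mem_nhdsWithin_of_mem_nhds (hV x)
    refine (EventuallyDominated.biUnion htc fun x hx => hVd x (htU hx)).mono ?_
    rw [← image_iUnion₂]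
    exact image_mono hcov
  have h2 : ¬ EventuallyDominated (f '' (U ∩ undominatedPoints f)) := fun h => hU <| by
    have := h.union h1
    rwa [← image_union, inter_union_sdiff] at this
  have h3 : ∃ N, ((fun y : ℕ → ℕ => y N) '' (f '' (U ∩ undominatedPoints f))).Infinite := by
    by_contra! h
    exact h2 (EventuallyDominated.of_finite_image
      (Eventually.of_forall fun n => not_infinite.1 (by simpa using h n)))
  obtain ⟨N, hN⟩ := h3
  refine ⟨N, Function.invFun fun i => (hN.natEmbedding _ i : ℕ), fun i => ?_⟩
  obtain ⟨_, ⟨x, hx, rfl⟩, hxi⟩ := (hN.natEmbedding _ i).2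
  refine ⟨x, hx, ?_⟩
  have hinj : Function.Injective fun i => (hN.natEmbedding _ i : ℕ) :=
    Subtype.val_injective.comp (hN.natEmbedding _).injective
  simp only at hxi
  rw [hxi]
  exact Function.leftInverse_invFun hinj i

/-- If the image of a continuous `f` is not eventually dominated, then it can be mapped onto
`ω^ω` continuously. -/
lemma exists_continuous_surjective_comp (hf : Continuous f)
    (hunb : ¬ EventuallyDominated (range f)) :
    ∃ d : (ℕ → ℕ) → ℕ → ℕ, Continuous d ∧ ∀ z, ∃ x, d (f x) = z := by
  let State := {p : (ℕ → ℕ) × ℕ // ¬ EventuallyDominated (f '' PiNat.cylinder p.1 p.2)}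
  let cyl : State → Set (ℕ → ℕ) := fun s => PiNat.cylinder s.1.1 s.1.2
  have step : ∀ s : State, ∃ (N : ℕ) (ψ : ℕ → ℕ) (next : ℕ → State), ∀ i,
      cyl (next i) ⊆ cyl s ∧ s.1.2 < (next i).1.2 ∧ ∀ x ∈ cyl (next i), ψ (f x N) = i := by
    intro s
    obtain ⟨N, ψ, h⟩ := exists_splitting_coordinate s.2
    choose x hx hxi using h
    have : ∀ i, ∃ n, s.1.2 < n ∧ ∀ y ∈ PiNat.cylinder (x i) n, f y N = f (x i) N := by
      intro i
      have hmem : {y | f y N = f (x i) N} ∈ 𝓝 (x i) :=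
        (isOpen_discrete {f (x i) N}).preimage ((continuous_apply N).comp hf) |>.mem_nhds rfl
      obtain ⟨_, ⟨y, n, rfl⟩, hy, hsub⟩ :=
        (PiNat.isTopologicalBasis_cylinders (fun _ => ℕ)).mem_nhds_iff.1 hmem
      rw [PiNat.mem_cylinder_iff_eq] at hy
      refine ⟨max n (s.1.2 + 1), by omega, fun z hz => hsub ?_⟩
      rw [← hy]
      exact PiNat.cylinder_anti _ (le_max_left _ _) hz
    choose n hn hny using this
    refine ⟨N, ψ, fun i => ⟨(x i, n i), (hx i).2 _
      ((PiNat.isOpen_cylinder _ _ _).mem_nhds (PiNat.self_mem_cylinder _ _))⟩, fun i =>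
      ⟨?_, hn i, fun y hy => by rw [hny i y hy, hxi]⟩⟩
    have := (hx i).1
    rw [PiNat.mem_cylinder_iff_eq] at this
    simp only [cyl]
    rw [← this]
    exact PiNat.cylinder_anti _ (hn i).le
  choose N ψ next hsub hlt hψ using step
  let root : State := ⟨(0, 0), by simpa using hunb⟩
  -- The branch is read off from `y` alone, each step using a single coordinate of `y`; hence `d` is
  -- continuous and total.
  let st : (ℕ → ℕ) → ℕ → State := fun y m =>
    Nat.rec root (fun _ s => next s (ψ s (y (N s)))) m
  have hst : ∀ y m, st y (m + 1) = next (st y m) (ψ (st y m) (y (N (st y m)))) := fun _ _ => rfl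
  have hcoord : ∀ g : (ℕ → ℕ) → State, IsLocallyConstant g →
      IsLocallyConstant fun y => ψ (g y) (y (N (g y))) := by
    intro g hg
    rw [IsLocallyConstant.iff_eventually_eq] at hg ⊢
    intro y
    have hy : ∀ᶠ y' in 𝓝 y, y' (N (g y)) = y (N (g y)) :=
      (continuous_apply (N (g y))).continuousAt.eventually (f := fun p : ℕ → ℕ => p (N (g y)))
        ((isOpen_discrete {y (N (g y))}).mem_nhds rfl)
    filter_upwards [hg y, hy] with y' h1 h2
    rw [h1, h2]
  have hloc : ∀ m, IsLocallyConstant fun y => st y m := by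
    intro m
    induction m with
    | zero => exact IsLocallyConstant.const _
    | succ m ih => exact ih.comp₂ (hcoord _ ih) next
  refine ⟨fun y m => ψ (st y m) (y (N (st y m))),
    continuous_pi fun m => (hcoord _ (hloc m)).continuous, fun z => ?_⟩
  let s : ℕ → State := fun m => Nat.rec root (fun m s => next s (z m)) m
  have hs : ∀ m, s (m + 1) = next (s m) (z m) := fun _ => rfl
  have hanti : Antitone fun m => cyl (s m) := antitone_nat_of_succ_le fun m => hsub _ _
  have hlen : ∀ m, m ≤ (s m).1.2 := by
    intro m
    induction m with
    | zero => exact Nat.zero_le _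
    | succ m ih =>
      have := hlt (s m) (z m)
      rw [← hs] at this
      omega
  -- Cylinder `j + 1` has length greater than `j`, so it fixes coordinate `j`.
  let x : ℕ → ℕ := fun j => (s (j + 1)).1.1 j
  have hx : ∀ m, x ∈ cyl (s m) := by
    intro m j hj
    rcases le_total m (j + 1) with h | h
    · exact hanti h (PiNat.self_mem_cylinder _ _) j hj
    · exact (hanti h (PiNat.self_mem_cylinder _ _) j (hlen (j + 1))).symm
  have hdec : ∀ m, ψ (s m) (f x (N (s m))) = z m := fun m =>
    hψ (s m) (z m) x (by rw [← hs]; exact hx (m + 1))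
  have heq : ∀ m, st (f x) m = s m := by
    intro m
    induction m with
    | zero => rfl
    | succ m ih => rw [hst, ih, hdec, hs]
  exact ⟨x, funext fun m => by simp only [heq, hdec]⟩

end Scheme

lemma MengerSubset.eventuallyDominated_range {C : Set (ℕ → ℕ)} (hC : MengerSubset C)
    {f : (ℕ → ℕ) → ℕ → ℕ} (hf : Continuous f) (hfC : range f ⊆ C) :
    EventuallyDominated (range f) := by
  by_contra hunb
  obtain ⟨d, hd, hsurj⟩ := exists_continuous_surjective_comp hf hunb
  refine hC.image_ne_univ hd (eq_univ_of_forall fun z => ?_)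
  obtain ⟨x, hx⟩ := hsurj z
  exact ⟨f x, hfC (mem_range_self x), hx⟩

theorem MengerSubset.eventuallyDominated_of_analyticSet {C : Set (ℕ → ℕ)} (hC : MengerSubset C)
    (hA : AnalyticSet C) : EventuallyDominated C := by
  rw [AnalyticSet] at hA
  rcases hA with rfl | ⟨f, hf, rfl⟩
  · exact ⟨0, fun y hy => hy.elim⟩
  · exact hC.eventuallyDominated_range hf subset_rfl

/-! ### Closure properties of σ-projective sets -/

namespace SigmaProjectiveSet

variable {P Q : Type} [TopologicalSpace P] [TopologicalSpace Q]

lemma iInter [PolishSpace P] {A : ℕ → Set P} (hA : ∀ n, SigmaProjectiveSet P (A n)) :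
    SigmaProjectiveSet P (⋂ n, A n) := by
  rw [← compl_compl (⋂ n, A n), compl_iInter]
  exact .compl _ _ (.iUnion _ _ fun n => .compl _ _ (hA n))

lemma inter [PolishSpace P] {A B : Set P} (hA : SigmaProjectiveSet P A)
    (hB : SigmaProjectiveSet P B) : SigmaProjectiveSet P (A ∩ B) := by
  have : A ∩ B = ⋂ n : ℕ, if n = 0 then A else B := by
    ext x
    simp only [mem_inter_iff, mem_iInter]
    refine ⟨fun h n => ?_, fun h => ⟨by simpa using h 0, by simpa using h 1⟩⟩
    split_ifs
    exacts [h.1, h.2]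
  rw [this]
  exact iInter fun n => by split_ifs <;> assumption

/-- Induction on generation works for projections because the image case becomes an image under `f ×
id`; general preimages then follow by projecting a graph. -/
lemma preimage_fst [PolishSpace Q] {A : Set P} (hA : SigmaProjectiveSet P A) :
    SigmaProjectiveSet (P × Q) (Prod.fst ⁻¹' A) := by
  induction hA with
  | isOpen P A hA => exact .isOpen _ _ (hA.preimage continuous_fst)
  | compl P A _ ih => exact .compl _ _ ih
  | iUnion P A _ ih =>
    rw [preimage_iUnion]
    exact .iUnion _ _ ih
  | image P R f A hf _ ih =>
    have : (Prod.fst ⁻¹' (f '' A) : Set (R × Q)) = Prod.map f id '' (Prod.fst ⁻¹' A) := by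
      ext ⟨r, q⟩
      simp [Prod.ext_iff]
    rw [this]
    exact .image _ _ _ _ (hf.prodMap continuous_id) ih

/-- The graph of a continuous function on `E` is the trace on `E × Q` of a `Gδ` set, so images of
`σ`-projective sets under partial continuous maps are `σ`-projective. -/
lemma image_of_continuousOn [PolishSpace P] [PolishSpace Q] {E : Set P}
    (hE : SigmaProjectiveSet P E) {f : P → Q} (hf : ContinuousOn f E) :
    SigmaProjectiveSet Q (f '' E) := by
  obtain ⟨b, hbc, -, hb⟩ := TopologicalSpace.exists_countable_basis Q
  have : ∀ V : b, ∃ U, IsOpen U ∧ f ⁻¹' V ∩ E = U ∩ E := fun V =>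
    continuousOn_iff'.1 hf _ (hb.isOpen V.2)
  choose U hUo hU using this
  have hmem : ∀ V : b, ∀ a ∈ E, (f a ∈ (V : Set Q) ↔ a ∈ U V) := fun V a ha => by
    simpa [ha] using Set.ext_iff.1 (hU V) a
  -- `G V` says that `q ∈ V` implies `p ∈ U V`. Over `E`, all these conditions together force `q = f
  -- p`.
  let G : b → Set (P × Q) := fun V => Prod.snd ⁻¹' (V : Set Q)ᶜ ∪ Prod.fst ⁻¹' U V
  have hG : ∀ V, SigmaProjectiveSet (P × Q) (G V) := fun V => by
    rw [← compl_compl (G V), compl_union]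
    refine .compl _ _ (inter ?_ (.compl _ _ (.isOpen _ _ ((hUo V).preimage continuous_fst))))
    rw [preimage_compl, compl_compl]
    exact .isOpen _ _ ((hb.isOpen V.2).preimage continuous_snd)
  have himage : f '' E = Prod.snd '' ((⋂ V, G V) ∩ Prod.fst ⁻¹' E : Set (P × Q)) := by
    ext q
    constructor
    · rintro ⟨p, hp, rfl⟩
      refine ⟨(p, f p), ⟨mem_iInter.2 fun V => ?_, hp⟩, rfl⟩
      by_cases h : f p ∈ (V : Set Q)
      · exact Or.inr ((hmem V p hp).1 h)
      · exact Or.inl h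
    · rintro ⟨⟨p, q⟩, ⟨hG, hp⟩, rfl⟩
      refine ⟨p, hp, ?_⟩
      by_contra hne
      obtain ⟨V, hV, hqV, hVsub⟩ := hb.exists_subset_of_mem_open
        (show q ∈ ({f p} : Set Q)ᶜ from fun h => hne h.symm) isOpen_compl_singleton
      rcases mem_iInter.1 hG ⟨V, hV⟩ with h | h
      · exact h hqV
      · exact hVsub ((hmem ⟨V, hV⟩ p hp).2 h) rfl
  rw [himage]
  refine .image _ _ _ _ continuous_snd (inter ?_ hE.preimage_fst)
  have := hbc.to_subtype
  rcases isEmpty_or_nonempty b with h | h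
  · rw [iInter_of_empty]
    exact .isOpen _ _ isOpen_univ
  · obtain ⟨e, he⟩ := exists_surjective_nat b
    rw [← he.iInter_comp]
    exact iInter fun n => hG _

lemma preimage [PolishSpace P] [PolishSpace Q] {A : Set Q} (hA : SigmaProjectiveSet Q A)
    {φ : P → Q} (hφ : Continuous φ) : SigmaProjectiveSet P (φ ⁻¹' A) := by
  have : φ ⁻¹' A = Prod.snd '' ({p | p.1 = φ p.2} ∩ Prod.fst ⁻¹' A : Set (Q × P)) := by
    ext x
    simp
  rw [this]
  refine .image _ _ _ _ continuous_snd (inter ?_ hA.preimage_fst)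
  rw [← compl_compl {p : Q × P | p.1 = φ p.2}]
  exact .compl _ _ (.isOpen _ _
    (isClosed_eq continuous_fst (hφ.comp continuous_snd)).isOpen_compl)

/-- The inverse of the embedding is a partial continuous map, so definability does not depend on the
ambient Polish space. -/
lemma of_isSigmaProjectiveSpace [PolishSpace Q] {A : Set Q} (hA : IsSigmaProjectiveSpace A) :
    SigmaProjectiveSet Q A := by
  obtain ⟨P, _, _, e, he, hE⟩ := hA
  rcases A.eq_empty_or_nonempty with rfl | ⟨a₀, ha₀⟩
  · exact .isOpen _ _ isOpen_empty
  have hne : Nonempty A := ⟨⟨a₀, ha₀⟩⟩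
  have hleft : ∀ a, Function.invFun e (e a) = a := Function.leftInverse_invFun he.injective
  have hcont : ContinuousOn (fun p => ((Function.invFun e p : A) : Q)) (range e) := by
    rw [continuousOn_iff_continuous_domRestrict]
    have : (range e).domRestrict (fun p => ((Function.invFun e p : A) : Q)) =
        Subtype.val ∘ he.toHomeomorph.symm := by
      funext p
      obtain ⟨a, rfl⟩ := he.toHomeomorph.surjective p
      rw [Function.comp_apply, Homeomorph.symm_apply_apply]
      exact congrArg Subtype.val (hleft a)
    rw [this]
    exact continuous_subtype_val.comp he.toHomeomorph.symm.continuous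
  have := hE.image_of_continuousOn hcont
  rw [← range_comp] at this
  convert this
  ext q
  simp [hleft]

end SigmaProjectiveSet

/-! ### The domination game -/

/-- The position after `n` moves when every move is dictated by the rule `ρ`. -/
def run (ρ : List ℕ → ℕ) : ℕ → List ℕ
  | 0 => []
  | n + 1 => run ρ n ++ [ρ (run ρ n)]

lemma length_run (ρ : List ℕ → ℕ) (n : ℕ) : (run ρ n).length = n := by
  induction n with
  | zero => rfl
  | succ n ih => simp [run, ih]

lemma position_run (ρ : List ℕ → ℕ) (n : ℕ) : position (fun i => ρ (run ρ i)) n = run ρ n := by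
  induction n with
  | zero => rfl
  | succ n ih =>
    rw [run, position, List.range_succ, List.map_append]
    exact congrArg (· ++ [ρ (run ρ n)]) ih

/-- The rule by which the player to move at even positions follows `σ` and the opponent plays the
successive terms of `k`. -/
def ruleI (σ : List ℕ → ℕ) (k : ℕ → ℕ) (l : List ℕ) : ℕ :=
  if Even l.length then σ l else k (l.length / 2)

/-- The rule by which the player to move at odd positions follows `τ` and the opponent plays the
successive terms of `y`. -/
def ruleII (τ : List ℕ → ℕ) (y : ℕ → ℕ) (l : List ℕ) : ℕ :=
  if Even l.length then y (l.length / 2) else τ l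

/-- Player I builds `y ∈ ω^ω` and wins if `y ∈ C` and infinitely often the next term of `y`
exceeds the number just played by player II. -/
def dominationGame (C : Set (ℕ → ℕ)) : Set (ℕ → ℕ) :=
  {x | (fun n => x (2 * n)) ∈ C ∧ ∃ᶠ n in atTop, x (2 * n + 1) < x (2 * (n + 1))}

lemma SigmaProjectiveSet.dominationGame {C : Set (ℕ → ℕ)}
    (hC : SigmaProjectiveSet (ℕ → ℕ) C) :
    SigmaProjectiveSet (ℕ → ℕ) (dominationGame C) := by
  have : DefinableMenger.dominationGame C = (fun x n => x (2 * n)) ⁻¹' C ∩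
      ⋂ m : ℕ, {x : ℕ → ℕ | ∃ n ≥ m, x (2 * n + 1) < x (2 * (n + 1))} := by
    ext x
    simp [DefinableMenger.dominationGame, frequently_atTop]
  rw [this]
  refine (hC.preimage (continuous_pi fun n => continuous_apply _)).inter
    (SigmaProjectiveSet.iInter fun m => .isOpen _ _ ?_)
  simp only [ofPred_exists, ofPred_and]
  exact isOpen_iUnion fun n => isOpen_const.inter
    (isOpen_lt (continuous_apply _) (continuous_apply _))

lemma exists_undominated_range_of_winning {C : Set (ℕ → ℕ)} {σ : List ℕ → ℕ}
    (hσ : ∀ x, FollowsI σ x → x ∈ dominationGame C) :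
    ∃ f : (ℕ → ℕ) → ℕ → ℕ, Continuous f ∧ range f ⊆ C ∧ ¬ EventuallyDominated (range f) := by
  let play : (ℕ → ℕ) → ℕ → ℕ := fun k n => ruleI σ k (run (ruleI σ k) n)
  have hodd : ∀ k n, play k (2 * n + 1) = k n := fun k n => by
    simp only [play, ruleI, length_run]
    rw [if_neg (by simp), show (2 * n + 1) / 2 = n by omega]
  have hfollow : ∀ k, FollowsI σ (play k) := fun k n => by
    rw [position_run]
    simp [play, ruleI, length_run]
  have hloc : ∀ n, IsLocallyConstant fun k => run (ruleI σ k) n := by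
    intro n
    induction n with
    | zero => exact IsLocallyConstant.const _
    | succ n ih =>
      rw [IsLocallyConstant.iff_eventually_eq] at ih ⊢
      intro k
      have hk : ∀ᶠ k' in 𝓝 k, k' (n / 2) = k (n / 2) :=
        (continuous_apply (n / 2)).continuousAt.eventually (f := fun p : ℕ → ℕ => p (n / 2))
          ((isOpen_discrete {k (n / 2)}).mem_nhds rfl)
      filter_upwards [ih k, hk] with k' h1 h2
      simp only [run, h1, ruleI, length_run, h2]
  have hplay : Continuous play := continuous_pi fun n => IsLocallyConstant.continuous <| by
    have := (hloc (n + 1)).comp fun l => l.getLastD 0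
    convert this using 2 with k
    simp [run, play]
  refine ⟨fun k n => play k (2 * n), continuous_pi fun n => (continuous_apply _).comp hplay,
    ?_, ?_⟩
  · rintro _ ⟨k, rfl⟩
    exact (hσ _ (hfollow k)).1
  · rintro ⟨g, hg⟩
    -- Against the moves `g (n + 1)` of II, I's winning play exceeds `g` infinitely often.
    have h1 := (hσ _ (hfollow fun n => g (n + 1))).2
    have h2 := (tendsto_add_atTop_nat 1).eventually (hg _ ⟨fun n => g (n + 1), rfl⟩)
    obtain ⟨n, hn, hn'⟩ := (h1.and_eventually h2).exists
    rw [hodd] at hn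
    exact absurd hn' (not_le.2 hn)

/-- When I plays `y ∈ C`, II wins, so from some round `m` on the terms of `y` obey the bounds given
by `τ`. For each of the countably many pairs of `m` and a position, such `y` form a finitely
branching tree. -/
lemma eventuallyDominated_of_winning {C : Set (ℕ → ℕ)} {τ : List ℕ → ℕ}
    (hτ : ∀ x, FollowsII τ x → x ∉ dominationGame C) : EventuallyDominated C := by
  let pos : (ℕ → ℕ) → ℕ → List ℕ := fun y n => run (ruleII τ y) (2 * n + 1)
  have hpos : ∀ y n, pos y (n + 1) = pos y n ++ [τ (pos y n)] ++ [y (n + 1)] := fun y n => by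
    have h1 : run (ruleII τ y) (2 * n + 2) = pos y n ++ [τ (pos y n)] := by
      rw [run]
      simp [pos, ruleII, length_run]
    have h2 : pos y (n + 1) = run (ruleII τ y) (2 * n + 2) ++
        [ruleII τ y (run (ruleII τ y) (2 * n + 2))] := rfl
    rw [h2, ruleII, length_run, if_pos ⟨n + 1, by omega⟩, h1,
      show (2 * n + 2) / 2 = n + 1 by omega]
  have key : ∀ (m : ℕ) (p : List ℕ), EventuallyDominated
      {y | pos y m = p ∧ ∀ n ≥ m, y (n + 1) ≤ τ (pos y n)} := by
    intro m p
    set K := {y | pos y m = p ∧ ∀ n ≥ m, y (n + 1) ≤ τ (pos y n)}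
    have hstep : ∀ n ≥ m, ((fun y => pos y n) '' K).Finite →
        ((fun y : ℕ → ℕ => y (n + 1)) '' K).Finite := by
      intro n hn hfin
      obtain ⟨b, hb⟩ := (hfin.image τ).bddAbove
      refine (finite_Iic b).subset ?_
      rintro _ ⟨y, hy, rfl⟩
      exact (hy.2 n hn).trans (hb ⟨_, ⟨y, hy, rfl⟩, rfl⟩)
    have hfin : ∀ n ≥ m, ((fun y => pos y n) '' K).Finite := by
      intro n hn
      induction n, hn using Nat.le_induction with
      | base =>
        refine (finite_singleton p).subset ?_
        rintro _ ⟨y, hy, rfl⟩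
        exact hy.1
      | succ n hn ih =>
        refine (ih.image2 (fun q v => q ++ [τ q] ++ [v]) (hstep n hn ih)).subset ?_
        rintro _ ⟨y, hy, rfl⟩
        exact ⟨_, ⟨y, hy, rfl⟩, _, ⟨y, hy, rfl⟩, (hpos y n).symm⟩
    refine EventuallyDominated.of_finite_image ?_
    filter_upwards [eventually_ge_atTop (m + 1)] with n hn
    obtain ⟨n, rfl⟩ : ∃ i, n = i + 1 := ⟨n - 1, by omega⟩
    exact hstep n (by omega) (hfin n (by omega))
  refine (EventuallyDominated.iUnion fun q : ℕ × List ℕ => key q.1 q.2).mono fun y hy => ?_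
  let x : ℕ → ℕ := fun n => ruleII τ y (run (ruleII τ y) n)
  have heven : ∀ n, x (2 * n) = y n := fun n => by simp [x, ruleII, length_run]
  have hodd : ∀ n, x (2 * n + 1) = τ (pos y n) := fun n => by
    simp [x, pos, ruleII, length_run]
  have hx : FollowsII τ x := fun n => by
    rw [hodd, position_run]
  have := hτ x hx
  simp only [dominationGame, mem_ofPred_eq, heven, hodd, hy, true_and, not_frequently,
    not_lt] at this
  obtain ⟨m, hm⟩ := eventually_atTop.1 this
  exact mem_iUnion.2 ⟨(m, pos y m), rfl, hm⟩

theorem MengerSubset.eventuallyDominated_of_sigmaProjectiveSet {C : Set (ℕ → ℕ)}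
    (hPD : SigmaPD) (hC : MengerSubset C) (hA : SigmaProjectiveSet (ℕ → ℕ) C) :
    EventuallyDominated C := by
  rcases hPD _ hA.dominationGame with ⟨σ, hσ⟩ | ⟨τ, hτ⟩
  · obtain ⟨f, hf, hfC, hunb⟩ := exists_undominated_range_of_winning hσ
    exact absurd (hC.eventuallyDominated_range hf hfC) hunb
  · exact eventuallyDominated_of_winning hτ

/-! ### Reduction to subsets of Baire space -/

lemma isHurewicz_of_isEmpty {X : Type u} [TopologicalSpace X] [IsEmpty X] :
    IsHurewicz X := fun _ _ =>
  ⟨fun _ => ∅, fun _ => ⟨empty_subset _, finite_empty⟩, fun x => isEmptyElim x⟩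

lemma IsMenger.lindelofSpace {X : Type u} [TopologicalSpace X] (hX : IsMenger X) :
    LindelofSpace X := by
  rw [← isLindelof_univ_iff]
  refine isLindelof_of_countable_subcover fun {ι} U hU hcov => ?_
  obtain ⟨V, hV, hcovV⟩ := hX (fun _ => range U) fun _ =>
    ⟨forall_mem_range.2 hU, by rw [sUnion_range]; exact univ_subset_iff.1 hcov⟩
  have hidx : ∀ s ∈ ⋃ n, V n, ∃ i, U i = s := iUnion_subset fun n => (hV n).1
  rcases isEmpty_or_nonempty ι with h | h
  · exact ⟨∅, countable_empty, by simpa using hcov⟩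
  choose! i hi using hidx
  refine ⟨i '' ⋃ n, V n, (countable_iUnion fun n => (hV n).2.countable).image i, fun x _ => ?_⟩
  obtain ⟨n, s, hs, hx⟩ := hcovV x
  have hs' := mem_iUnion_of_mem n hs
  exact mem_biUnion (mem_image_of_mem i hs') (by rwa [hi s hs'])

lemma IsMenger.mengerSubset_range {X Z : Type*} [TopologicalSpace X] [TopologicalSpace Z]
    (hX : IsMenger X) {F : X → Z} (hF : Continuous F) : MengerSubset (range F) := by
  intro W hW hcov
  obtain ⟨V, hV, hcovV⟩ := hX (fun n => range fun k => F ⁻¹' W n k) fun n =>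
    ⟨forall_mem_range.2 fun k => (hW n k).preimage hF, by
      rw [sUnion_range, ← preimage_iUnion]
      exact preimage_eq_univ_iff.2 (hcov n)⟩
  have : ∀ n, ∃ b, ∀ s ∈ V n, ∃ k ≤ b, s = F ⁻¹' W n k := fun n => by
    have hk : ∀ s ∈ V n, ∃ k, s = F ⁻¹' W n k := fun s hs => by
      obtain ⟨k, hk⟩ := (hV n).1 hs
      exact ⟨k, hk.symm⟩
    choose! k hk using hk
    obtain ⟨b, hb⟩ := ((hV n).2.image k).bddAbove
    exact ⟨b, fun s hs => ⟨k s, hb (mem_image_of_mem k hs), hk s hs⟩⟩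
  choose g hg using this
  refine ⟨g, forall_mem_range.2 fun x => ?_⟩
  obtain ⟨n, s, hs, hx⟩ := hcovV x
  obtain ⟨k, hk, rfl⟩ := hg n s hs
  exact ⟨n, k, hk, hx⟩

open unitInterval in
/-- In a Lindelöf completely regular space every open cover has a countable refinement by cozero
sets. -/
lemma exists_countable_cozero_refinement {X : Type u} [TopologicalSpace X] [Nonempty X]
    [CompletelyRegularSpace X] [LindelofSpace X] {U : Set (Set X)} (hU : ∀ s ∈ U, IsOpen s)
    (hcov : ⋃₀ U = univ) :
    ∃ (f : ℕ → X → I) (u : ℕ → Set X), (∀ k, Continuous (f k)) ∧ (∀ k, u k ∈ U) ∧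
      (∀ k x, f k x < 1 → x ∈ u k) ∧ ∀ x, ∃ k, f k x < 1 := by
  have : ∀ x : X, ∃ (f : X → I) (u : Set X), Continuous f ∧ u ∈ U ∧ f x = 0 ∧
      ∀ y, f y < 1 → y ∈ u := fun x => by
    obtain ⟨u, hu, hx⟩ := hcov.symm ▸ mem_univ x
    obtain ⟨f, hf, hfx, hfu⟩ := CompletelyRegularSpace.completely_regular_isOpen x u (hU u hu) hx
    refine ⟨f, u, hf, hu, hfx, fun y hy => ?_⟩
    by_contra h
    exact hy.ne (hfu h)
  choose f u hf hu hfx hfu using this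
  have hopen : ∀ x, IsOpen {y | f x y < 1} := fun x => isOpen_lt (hf x) continuous_const
  obtain ⟨t, htc, ht⟩ := LindelofSpace.elim_nhds_subcover (fun x => {y | f x y < 1})
    fun x => (hopen x).mem_nhds (by simp [hfx])
  have htne : t.Nonempty := by
    by_contra h
    rw [not_nonempty_iff_eq_empty] at h
    simp only [h, biUnion_empty] at ht
    exact empty_ne_univ ht
  obtain ⟨e, rfl⟩ := htc.exists_eq_range htne
  refine ⟨fun k => f (e k), fun k => u (e k), fun k => hf _, fun k => hu _,
    fun k x hx => hfu _ x hx, fun x => ?_⟩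
  simpa using (ht ▸ mem_univ x : x ∈ ⋃ y ∈ range e, {z | f y z < 1})

lemma exists_clopen_refinement {K : Type*} [TopologicalSpace K] [CompactSpace K] [T2Space K]
    [TotallyDisconnectedSpace K] [SecondCountableTopology K] {O : ℕ → Set K}
    (hO : ∀ k, IsOpen (O k)) :
    ∃ (V : ℕ → Set K) (r : ℕ → ℕ), (∀ j, IsClopen (V j)) ∧ (∀ j, V j ⊆ O (r j)) ∧
      ⋃ k, O k ⊆ ⋃ j, V j := by
  obtain ⟨T, hTc, hTS, hT⟩ := TopologicalSpace.isOpen_sUnion_countable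
    {s : Set K | IsClopen s ∧ ∃ k, s ⊆ O k} fun s hs => hs.1.isOpen
  -- Adding `∅` guarantees a nonempty family to enumerate.
  obtain ⟨V, hV⟩ := (hTc.insert ∅).exists_eq_range (insert_nonempty _ _)
  have hmem : ∀ j, IsClopen (V j) ∧ ∃ k, V j ⊆ O k := fun j => by
    have : V j ∈ insert ∅ T := hV ▸ mem_range_self j
    rcases this with h | h
    · rw [h]
      exact ⟨isClopen_empty, 0, empty_subset _⟩
    · exact hTS h
  choose hVc r hr using hmem
  refine ⟨V, r, hVc, hr, fun x hx => ?_⟩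
  obtain ⟨k, hk⟩ := mem_iUnion.1 hx
  obtain ⟨s, hs, hxs, hsk⟩ := (isTopologicalBasis_isClopen (X := K)).exists_subset_of_mem_open
    hk (hO k)
  have : x ∈ ⋃₀ T := hT ▸ ⟨s, ⟨hs, k, hsk⟩, hxs⟩
  obtain ⟨s, hs, hxs⟩ := this
  obtain ⟨j, rfl⟩ := (hV ▸ mem_insert_of_mem _ hs : s ∈ range V)
  exact mem_iUnion.2 ⟨j, hxs⟩

open Classical in
-- Membership in the first clopen set and avoidance of the earlier ones is an open condition, so the
-- index is locally constant on the union; the default 0 occurs only outside it.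
lemma continuousOn_find {K : Type*} [TopologicalSpace K] {V : ℕ → Set K}
    (hV : ∀ j, IsClopen (V j)) :
    ContinuousOn (fun x => if h : ∃ j, x ∈ V j then Nat.find h else 0)
      (⋃ j, V j) := by
  intro x hx
  have hex : ∃ j, x ∈ V j := mem_iUnion.1 hx
  set m := Nat.find hex with hm
  have hN : V m ∩ ⋂ i ∈ Iio m, (V i)ᶜ ∈ 𝓝 x :=
    ((hV m).isOpen.inter ((finite_Iio m).isOpen_biInter fun i _ =>
      (hV i).compl.isOpen)).mem_nhds
      ⟨Nat.find_spec hex, mem_iInter₂.2 fun i hi => Nat.find_min hex hi⟩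
  refine ContinuousAt.continuousWithinAt ((continuousAt_const (y := m)).congr ?_)
  filter_upwards [hN] with y hy
  have hey : ∃ j, y ∈ V j := ⟨m, hy.1⟩
  rw [dif_pos hey, eq_comm, Nat.find_eq_iff]
  exact ⟨hy.1, fun i hi => mem_iInter₂.1 hy.2 i hi⟩

lemma polishSpace_bool : PolishSpace Bool :=
  (IsClosedEmbedding.of_continuous_injective_isClosedMap (f := Bool.toNat)
    continuous_of_discreteTopology (by decide)
    fun _ _ => isClosed_discrete _).polishSpace

open unitInterval in
/-- A Menger completely regular space is Hurewicz as soon as certain Menger subsets of `ω^ω`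
obtained from continuous images of it in the Hilbert cube are eventually dominated. -/
theorem IsMenger.isHurewicz {X : Type u} [TopologicalSpace X] [CompletelyRegularSpace X]
    (hX : IsMenger X)
    (H : ∀ (F : X → ℕ × ℕ → I) (φ : (ℕ → Bool) → ℕ × ℕ → I) (h : (ℕ → Bool) → ℕ → ℕ),
      Continuous F → Continuous φ → ContinuousOn h (φ ⁻¹' range F) →
      MengerSubset (h '' (φ ⁻¹' range F)) → EventuallyDominated (h '' (φ ⁻¹' range F))) :
    IsHurewicz X := by
  classical
  rcases isEmpty_or_nonempty X with hempty | hne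
  · exact isHurewicz_of_isEmpty
  intro U hU
  have := hX.lindelofSpace
  choose f u hf hu hfu hcov using fun n => exists_countable_cozero_refinement (hU n).1 (hU n).2
  let F : X → ℕ × ℕ → I := fun x p => f p.1 p.2 x
  have hF : Continuous F := continuous_pi fun p => hf _ _
  obtain ⟨φ, hφ, hsurj⟩ : ∃ φ : (ℕ → Bool) → ℕ × ℕ → I, Continuous φ ∧ Function.Surjective φ := by
    let _ := TopologicalSpace.metrizableSpaceMetric (ℕ × ℕ → I)
    exact exists_nat_bool_continuous_surjective_of_compact _
  choose V r hV hVr hVcov using fun n => exists_clopen_refinement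
    (O := fun k => {x | φ x (n, k) < 1})
    fun k => isOpen_lt ((continuous_apply _).comp hφ) continuous_const
  let h : (ℕ → Bool) → ℕ → ℕ := fun x n => if h : ∃ j, x ∈ V n j then Nat.find h else 0
  have hB : ∀ n, φ ⁻¹' range F ⊆ ⋃ j, V n j := by
    rintro n x ⟨a, ha⟩
    obtain ⟨k, hk⟩ := hcov n a
    refine hVcov n (mem_iUnion.2 ⟨k, ?_⟩)
    simpa [← ha, F] using hk
  have hh : ContinuousOn h (φ ⁻¹' range F) :=
    continuousOn_pi.2 fun n => (continuousOn_find (hV n)).mono (hB n)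
  have hspec : ∀ x ∈ φ ⁻¹' range F, ∀ n, x ∈ V n (h x n) := fun x hx n => by
    have hex : ∃ j, x ∈ V n j := mem_iUnion.1 (hB n hx)
    simp only [h, dif_pos hex]
    exact Nat.find_spec hex
  obtain ⟨g, hg⟩ := H F φ h hF hφ hh
    (((hX.mengerSubset_range hF).preimage_of_compactSpace hφ).image_of_continuousOn hh)
  refine ⟨fun n => (fun j => u n (r n j)) '' Iic (g n), fun n =>
    ⟨image_subset_iff.2 fun j _ => hu _ _, (finite_Iic _).image _⟩, fun a => ?_⟩
  obtain ⟨x, hx⟩ := hsurj (F a)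
  have hxB : x ∈ φ ⁻¹' range F := ⟨a, hx.symm⟩
  filter_upwards [hg _ (mem_image_of_mem h hxB)] with n hn
  refine ⟨_, ⟨h x n, hn, rfl⟩, hfu _ _ _ ?_⟩
  have := hVr n _ (hspec x hxB n)
  simpa [hx, F] using this

end DefinableMenger

theorem mainTheorem2 (X : Type u) [TopologicalSpace X] [CompletelyRegularSpace X] :
    (DefinableMenger.IsMenger X →
      DefinableMenger.Projectively DefinableMenger.IsAnalyticSpace X →
      DefinableMenger.IsHurewicz X) ∧
    (DefinableMenger.SigmaPD → DefinableMenger.IsMenger X →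
      DefinableMenger.Projectively DefinableMenger.IsSigmaProjectiveSpace X →
      DefinableMenger.IsHurewicz X) := by
  have := DefinableMenger.polishSpace_bool
  refine ⟨fun hX hA => hX.isHurewicz fun F φ h hF hφ hh hC => ?_,
    fun hPD hX hA => hX.isHurewicz fun F φ h hF hφ hh hC => ?_⟩
  -- Analyticity passes from `range F` to its preimage under `φ`, then to the image under `h`.
  · refine hC.eventuallyDominated_of_analyticSet (AnalyticSet.image_of_continuousOn ?_ hh)
    refine AnalyticSet.preimage ?_ hφ
    have := (hA _ F hF).image_of_continuous continuous_subtype_val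
    rwa [image_univ, Subtype.range_coe] at this
  · refine hC.eventuallyDominated_of_sigmaProjectiveSet hPD
      (DefinableMenger.SigmaProjectiveSet.image_of_continuousOn ?_ hh)
    exact (DefinableMenger.SigmaProjectiveSet.of_isSigmaProjectiveSpace (hA _ F hF)).preimage hφ
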